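/- **Setting.** There are $m$ disjoint communities $C_1,\dots,C_m$ with (unknown) sizes $d_i\ge 1$, and a budget $K>m$ per round. Put $\mu_i=1/d_i$ and $K'=K-m+1$. In rounds $t=1,2,\dots$ the random realizations $\Phi_t=(\Phi_t(i,\tau))_{i\in[m],\tau\in[K]}$ are independent, all $\Phi_t(i,\tau)$ being independent and uniform on $C_i$. For an allocation $\bm k\in\mathbb{Z}_{\ge 0}^m$ let $R(\bm k,\Phi)=\sum_{i}|\{\Phi(i,1),\dots,\Phi(i,k_i)\}|$ be the number of distinct members met and $r_{\bm k}(\bm\mu)=\mathbb{E}_\Phi[R(\bm k,\Phi)]$. Let $\bm k^*$ maximize $r_{\bm k}(\bm\mu)$ over $\sum_i k_i\le K$, and for $\sum_i k_i=K$ let $\Delta_{\bm k}=r_{\bm k^*}(\bm\mu)-r_{\bm k}(\bm\mu)$. Put $\Delta^i_{\min}=\min\{\Delta_{\bm k}: \Delta_{\bm k}>0,\ k_i>1\}$ and $\Delta^i_{\max}=\max\{\Delta_{\bm k}: \Delta_{\bm k}>0,\ k_i>1\}$ ($\infty$ and $0$ if there is no such $\bm k$ with $\sum_i k_i=K$), $\Delta_{\min}=\min_i\Delta^i_{\min}$,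 $\Delta_{\max}=\max_i\Delta^i_{\max}$. **Algorithm (CLCB, non-adaptive, with full information feedback).** For each $i$ keep a number of pairs $T_i$, a number of collisions $X_i$ (both initially $0$), and the empirical mean $\hat\mu_i=X_i/T_i$ ($\hat\mu_i=0$ as long as there is no pair). In round $t$ the allocation $\bm k_t$ is computed greedily from $\hat{\bm\mu}$: start with $\bm k=0$ and, $K$ times, increase $k_i$ by one for some $i\in\operatorname{argmax}_j(1-\hat\mu_j)^{k_j}$; ties may be broken in any way (for example uniformly at random) that depends only on the past and on additional randomness independent of the coming realizations. Then $C_i$ is explored $k_{i,t}$ times for each $i$, and the members $u_1,\dots,u_{k_{i,t}}$ are met, $u_x=\Phi_t(i,x)$. With $u_0$ the last member of $C_i$ met before round $t$ (null if there is none), update $T_i\leftarrow T_i+k_{i,t}-\mathbb{1}\{t=1\}$ and $X_i\leftarrow X_i+\sum_{x=0}^{k_{i,t}-1}\mathbb{1}\{u_x=u_{x+1}\}$. **Theorem.** For every $T$, the $T$-round regret $\mathrm{Reg}_{\bm\mu}(T)=\mathbb{E}\big[\sum_{t=1}^T \big(R(\bm k^*,\Phi_t)-R(\bm k_t,\Phi_t)\big)\big]$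 of this algorithm is bounded by a constant that does not depend on $T$: $$\mathrm{Reg}_{\bm\mu}(T)\le\Big(2+\frac{2me^2K'^2(K'-1)^2}{\Delta_{\min}^2}\Big)\Delta_{\max}.$$ -/

import Mathlib

open MeasureTheory ProbabilityTheory
open scoped ENNReal

noncomputable section

namespace CommunityExploration

/-- A realization: the member `φ i τ` of community `i` (which has `d i` members) that is met in
the `τ`-th exploration of community `i`, for every item `(i, τ)` with `i ∈ [m]`, `τ ∈ [K]`. -/
abbrev Realization {m : ℕ} (d : Fin m → ℕ) (K : ℕ) : Type := (i : Fin m) → Fin K → Fin (d i)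

/-- A budget allocation `k = (k_1, …, k_m)`. -/
abbrev Allocation (m : ℕ) : Type := Fin m → ℕ

/-- The distribution of a random realization: all `Φ(i, τ)` are independent and uniform on their
communities, that is, `Φ` is uniform on the (finite) product of all communities. -/
def realizationLaw {m : ℕ} (d : Fin m → ℕ) (K : ℕ) : Measure (Realization d K) :=
  uniformOn Set.univ

/-- The members of community `i` met when it is explored `n` times (`n ≤ K`), in the order in
which they are met. -/
def met {m K : ℕ} {d : Fin m → ℕ} (φ : Realization d K) (i : Fin m) (n : ℕ) : List (Fin (d i)) :=
  ((List.finRange K).take n).map (φ i)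

/-- The reward `R(k, φ)`: the number of distinct members met. -/
def reward {m K : ℕ} {d : Fin m → ℕ} (k : Allocation m) (φ : Realization d K) : ℕ :=
  ∑ i, (met φ i (k i)).toFinset.card

/-- The expected reward `r_k(μ) = E_Φ[R(k, Φ)]`. -/
def expReward {m : ℕ} (d : Fin m → ℕ) (K : ℕ) (k : Allocation m) : ℝ :=
  ∫ φ, (reward k φ : ℝ) ∂(realizationLaw d K)

/-- `k` is an optimal budget allocation: it maximizes the expected reward among all allocations
of total at most `K`. -/
def IsOptimal {m : ℕ} (d : Fin m → ℕ) (K : ℕ) (k : Allocation m) : Prop :=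
  ∑ i, k i ≤ K ∧ ∀ k' : Allocation m, ∑ i, k' i ≤ K → expReward d K k' ≤ expReward d K k

/-- `GreedySteps μ s k`: after `s` steps, the greedy allocation procedure run with parameters `μ`
can have reached the allocation `k`. Each step gives one more exploration to an element `i` of
`argmax_j (1 - μ_j)^{k_j}`; every choice in the argmax is admitted. -/
inductive GreedySteps {m : ℕ} (μ : Fin m → ℝ) : ℕ → Allocation m → Prop
  | zero : GreedySteps μ 0 (fun _ => 0)
  | step (s : ℕ) (k : Allocation m) (i : Fin m) (hk : GreedySteps μ s k)
      (hi : ∀ j, (1 - μ j) ^ k j ≤ (1 - μ i) ^ k i) :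
      GreedySteps μ (s + 1) (Function.update k i (k i + 1))

/-- The number `∑_{x=0}^{n-1} 1{u_x = u_{x+1}}` of collisions of consecutive members, where
`u_1, …, u_n` is the list and `u_0` is a member or `none` (no member). -/
def collisions {α : Type} [DecidableEq α] : Option α → List α → ℕ
  | _, [] => 0
  | u, v :: S => (if u = some v then 1 else 0) + collisions (some v) S

/-- What the learner keeps for a community with `n` members: the number of pairs `T_i`, the number
of collisions `X_i`, and the last member met (`none` if no member was met so far). -/
structure Stats (n : ℕ) where
  /-- the number of pairs -/
  T : ℤ
  /-- the number of collisions -/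
  X : ℕ
  /-- the last member met -/
  last : Option (Fin n)

/-- The statistics of community `i` at the end of the first `t` rounds, when `φ s` and `k s` are
the realization and the allocation in the `(s + 1)`-st round. In every round the list `S_i` of met
members adds `|S_i| - 1{first round}` to `T_i`, and the collisions of consecutive members,
including the pair formed with the last member met before, to `X_i`. -/
def stats {m K : ℕ} {d : Fin m → ℕ} (φ : ℕ → Realization d K) (k : ℕ → Allocation m) (i : Fin m) :
    ℕ → Stats (d i)
  | 0 => ⟨0, 0, none⟩
  | t + 1 =>
    let st := stats φ k i t
    let S := met (φ t) i (k t i)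
    { T := st.T + (S.length : ℤ) - (if t = 0 then 1 else 0)
      X := st.X + collisions st.last S
      last := S.getLast?.or st.last }

/-- The empirical mean `X_i / T_i` at the end of the first `t` rounds; it has its initial value
`0` as long as there is no pair. -/
def empMean {m K : ℕ} {d : Fin m → ℕ} (φ : ℕ → Realization d K) (k : ℕ → Allocation m) (t : ℕ)
    (i : Fin m) : ℝ :=
  if 0 < (stats φ k i t).T then ((stats φ k i t).X : ℝ) / ((stats φ k i t).T : ℝ) else 0

/-- `Φ` and `k` are the realizations and the allocations of `T` rounds of the learning algorithm
with full information feedback (`Φ t`, `k t` belong to the `(t + 1)`-st round):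
the realization of each round has the law of a random realization and is independent of the
realizations of the earlier rounds and of the allocations chosen up to and including this round;
the allocation of each round is an output of the greedy procedure, run for `K` steps on the
empirical means of the earlier rounds. The way in which ties in the greedy procedure are broken
may depend on the past and on additional randomness. -/
structure IsRun {m : ℕ} (d : Fin m → ℕ) (K T : ℕ) {Ω : Type*} [MeasurableSpace Ω] (P : Measure Ω)
    (Φ : ℕ → Ω → Realization d K) (k : ℕ → Ω → Allocation m) : Prop where
  measurable_realization : ∀ t < T, Measurable (Φ t)
  measurable_allocation : ∀ t < T, Measurable (k t)
  law : ∀ t < T, P.map (Φ t) = realizationLaw d K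
  indep : ∀ t < T, IndepFun
    (fun ω => ((fun s : Fin t => Φ s ω), (fun s : Fin (t + 1) => k s ω))) (Φ t) P
  greedy : ∀ t < T, ∀ ω,
    GreedySteps (empMean (fun s => Φ s ω) (fun s => k s ω) t) K (k t ω)

/-- The `T`-round regret with respect to the allocation `kstar`. -/
def regret {m : ℕ} {d : Fin m → ℕ} {K : ℕ} (T : ℕ) {Ω : Type*} [MeasurableSpace Ω] (P : Measure Ω)
    (Φ : ℕ → Ω → Realization d K) (k : ℕ → Ω → Allocation m) (kstar : Allocation m) : ℝ :=
  ∫ ω, ∑ t ∈ Finset.range T, ((reward kstar (Φ t ω) : ℝ) - (reward (k t ω) (Φ t ω) : ℝ)) ∂P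

/-- The reward gap `Δ_k = r_{k*}(μ) - r_k(μ)`. -/
def gap {m : ℕ} (d : Fin m → ℕ) (K : ℕ) (kstar k : Allocation m) : ℝ :=
  expReward d K kstar - expReward d K k

/-- The actions `k` (of total exactly `K`) with `k_i > 1` and `Δ_k > 0`. -/
def badActions {m : ℕ} (d : Fin m → ℕ) (K : ℕ) (kstar : Allocation m) (i : Fin m) :
    Set (Allocation m) :=
  {k | ∑ j, k j = K ∧ 1 < k i ∧ 0 < gap d K kstar k}

/-- `Δ_min = min_i Δ^i_min`, where `Δ^i_min` is the least gap of the actions in `badActions i`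
(and `∞` if there are none). -/
def gapMin {m : ℕ} (d : Fin m → ℕ) (K : ℕ) (kstar : Allocation m) : ℝ≥0∞ :=
  ⨅ i, ⨅ k ∈ badActions d K kstar i, ENNReal.ofReal (gap d K kstar k)

/-- `Δ_max = max_i Δ^i_max`, where `Δ^i_max` is the largest gap of the actions in `badActions i`
(and `0` if there are none). -/
def gapMax {m : ℕ} (d : Fin m → ℕ) (K : ℕ) (kstar : Allocation m) : ℝ≥0∞ :=
  ⨆ i, ⨆ k ∈ badActions d K kstar i, ENNReal.ofReal (gap d K kstar k)

end CommunityExploration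

end

/-!
Under a parameter vector `μ` the expected reward of an allocation `a` is
`∑ i, ∑ j < a i, (1 - μ i) ^ j`. The summands decrease in `j`, so the greedy procedure run on the
empirical means maximizes the reward under these means. If it explores every community, the reward
changes by at most `K' (K' - 1) / 2` times the largest error of the means when they are replaced by
the true collision probabilities, for the greedy allocation and for an optimal one alike. If it
leaves a community unexplored, some community explored at least twice has empirical mean `0`, and
the true collision probability of such a community is itself large compared with `Δ_min`. Either
way, a round with a positive gap explores a community whose empirical mean is off by at least
`ε = Δ_min / (K' (K' - 1))`.

For each community such rounds are rare. Consecutive members collide independently with probability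
`p`. If `X` of `N` pairs collide, then for small `c` the exponential of `c (X - N p)`, discounted by
`exp (-c ^ 2)` per pair and once more per exploration, is a supermartingale that loses a fixed
fraction of its value whenever the community is explored. Hence its expected values over the rounds
exploring the community have a bounded sum. With `c = ± ε / 2` it is at least `exp (-c ^ 2)` for
one sign whenever the error is at least `ε`, and Markov's inequality bounds the expected number of
these rounds by `2 e ^ 2 / ε ^ 2`, uniformly in the horizon.
-/

namespace CommunityExploration

section Greedy

variable {m : ℕ}

/-- The expected reward `r_k(μ)` as a function of an arbitrary vector `μ` of collision
probabilities; the greedy procedure is run on estimates of the true vector. -/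
noncomputable def paramReward (μ : Fin m → ℝ) (k : Allocation m) : ℝ :=
  ∑ i, ∑ j ∈ Finset.range (k i), (1 - μ i) ^ j

lemma update_add_one (k : Allocation m) (i : Fin m) :
    Function.update k i (k i + 1) = k + Pi.single i 1 := by
  ext l
  rcases eq_or_ne l i with rfl | hl <;> simp [*]

lemma sum_add_single (k : Allocation m) (i : Fin m) :
    ∑ l, (k + Pi.single i 1 : Allocation m) l = ∑ l, k l + 1 := by
  simp [Finset.sum_add_distrib]

lemma paramReward_add_single (μ : Fin m → ℝ) (k : Allocation m) (i : Fin m) :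
    paramReward μ (k + Pi.single i 1) = paramReward μ k + (1 - μ i) ^ k i := by
  have hterm (l : Fin m) :
      ∑ j ∈ Finset.range (k l + (Pi.single i 1 : Allocation m) l), (1 - μ l) ^ j
        = ∑ j ∈ Finset.range (k l), (1 - μ l) ^ j
          + (Pi.single i ((1 - μ i) ^ k i) : Fin m → ℝ) l := by
    rcases eq_or_ne l i with rfl | hl <;> simp [Finset.sum_range_succ, *]
  simp [paramReward, hterm, Finset.sum_add_distrib]

lemma exists_one_lt_of_lt_sum {k : Allocation m} (h : m < ∑ i, k i) : ∃ i, 1 < k i := by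
  obtain ⟨i, -, hi⟩ := Finset.exists_lt_of_sum_lt (s := Finset.univ) (f := fun _ : Fin m => 1)
    (by simpa using h)
  exact ⟨i, hi⟩

lemma exists_one_lt_of_eq_zero {k : Allocation m} (h : m ≤ ∑ i, k i) {z : Fin m}
    (hz : k z = 0) : ∃ i, 1 < k i := by
  obtain ⟨i, hi⟩ := exists_one_lt_of_lt_sum
    (h.trans_lt (Nat.lt_succ_self _) |>.trans_eq (sum_add_single k z).symm)
  rcases eq_or_ne i z with rfl | hiz
  · simp [hz] at hi
  · exact ⟨i, by simpa [hiz] using hi⟩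

lemma add_le_of_forall_one_le {k : Allocation m} (h1 : ∀ i, 1 ≤ k i) (i : Fin m) :
    k i + m ≤ ∑ l, k l + 1 := by
  have h : ∑ l ∈ Finset.univ.erase i, 1 ≤ ∑ l ∈ Finset.univ.erase i, k l :=
    Finset.sum_le_sum fun l _ => h1 l
  have hsplit := Finset.add_sum_erase Finset.univ k (Finset.mem_univ i)
  simp only [Finset.sum_const, Finset.card_erase_of_mem (Finset.mem_univ i), Finset.card_univ,
    Fintype.card_fin, smul_eq_mul, mul_one] at h
  omega

lemma exists_mem_Icc_sum_eq {ι : Type*} [Fintype ι] {a b : ι → ℕ} (hab : a ≤ b) {n : ℕ}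
    (ha : ∑ i, a i ≤ n) (hb : n ≤ ∑ i, b i) : ∃ c ∈ Set.Icc a b, ∑ i, c i = n := by
  classical
  induction n, ha using Nat.le_induction with
  | base => exact ⟨a, ⟨le_rfl, hab⟩, rfl⟩
  | succ n _ ih =>
    obtain ⟨c, ⟨hac, hcb⟩, hc⟩ := ih (Nat.le_of_succ_le hb)
    obtain ⟨i, -, hi⟩ := Finset.exists_lt_of_sum_lt (hc.trans_lt hb)
    refine ⟨c + Pi.single i 1, ⟨fun l => (hac l).trans (by simp), fun l => ?_⟩, ?_⟩
    · rcases eq_or_ne l i with rfl | hl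
      · simpa using hi
      · simpa [hl] using hcb l
    · simp [Finset.sum_add_distrib, hc]

variable {s : ℕ} {μ : Fin m → ℝ} {k : Allocation m}

lemma exists_greedySteps [Nonempty (Fin m)] (μ : Fin m → ℝ) (s : ℕ) :
    ∃ k, GreedySteps μ s k := by
  induction s with
  | zero => exact ⟨_, .zero⟩
  | succ s ih =>
    obtain ⟨k, hk⟩ := ih
    obtain ⟨i, hi⟩ := Finite.exists_max fun j => (1 - μ j) ^ k j
    exact ⟨_, .step s k i hk hi⟩

lemma GreedySteps.sum_eq (h : GreedySteps μ s k) : ∑ i, k i = s := by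
  induction h with
  | zero => simp
  | step s k i hk hi ih => rw [update_add_one, sum_add_single, ih]

lemma antitone_one_sub_pow {x : ℝ} (hx : x ∈ Set.Icc 0 1) : Antitone fun j : ℕ => (1 - x) ^ j :=
  pow_right_anti₀ (Set.Icc.one_sub_mem hx).1 (Set.Icc.one_sub_mem hx).2

-- The threshold is the marginal gain of the last step.
lemma GreedySteps.exists_threshold (h : GreedySteps μ s k) (hμ : ∀ i, μ i ∈ Set.Icc 0 1) :
    ∃ θ : ℝ, 0 ≤ θ ∧ ∀ i, (1 - μ i) ^ k i ≤ θ ∧ ∀ j < k i, θ ≤ (1 - μ i) ^ j := by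
  induction h with
  | zero => exact ⟨1, zero_le_one, fun i => by simp⟩
  | step _ k i _ hi ih =>
    obtain ⟨θ, -, hθ⟩ := ih
    refine ⟨(1 - μ i) ^ k i, pow_nonneg (Set.Icc.one_sub_mem (hμ i)).1 _, fun l => ?_⟩
    rcases eq_or_ne l i with rfl | hl
    · rw [Function.update_self]
      exact ⟨antitone_one_sub_pow (hμ l) (Nat.le_succ _),
        fun j hj => antitone_one_sub_pow (hμ l) (Nat.le_of_lt_succ hj)⟩
    · rw [Function.update_of_ne hl]
      exact ⟨hi l, fun j hj => (hθ i).1.trans ((hθ l).2 j hj)⟩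

lemma sum_range_sub_le_of_threshold {f : ℕ → ℝ} {θ : ℝ} {k : ℕ} (hf : Antitone f)
    (hge : f k ≤ θ) (hlt : ∀ j < k, θ ≤ f j) (n : ℕ) :
    ∑ j ∈ Finset.range n, f j - ∑ j ∈ Finset.range k, f j ≤ θ * ((n : ℝ) - k) := by
  rcases le_total k n with h | h
  · rw [← Finset.sum_Ico_eq_sub _ h]
    have := Finset.sum_le_card_nsmul (Finset.Ico k n) f θ
      fun j hj => (hf (Finset.mem_Ico.1 hj).1).trans hge
    rw [Nat.card_Ico, nsmul_eq_mul, Nat.cast_sub h] at this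
    linarith
  · rw [← neg_sub, ← Finset.sum_Ico_eq_sub _ h]
    have := Finset.card_nsmul_le_sum (Finset.Ico n k) f θ fun j hj => hlt j (Finset.mem_Ico.1 hj).2
    rw [Nat.card_Ico, nsmul_eq_mul, Nat.cast_sub h] at this
    linarith

lemma GreedySteps.paramReward_le (h : GreedySteps μ s k) (hμ : ∀ i, μ i ∈ Set.Icc 0 1)
    {k' : Allocation m} (hk' : ∑ i, k' i ≤ s) : paramReward μ k' ≤ paramReward μ k := by
  obtain ⟨θ, hθ0, hθ⟩ := h.exists_threshold hμ
  have hle : (∑ i, (k' i : ℝ)) ≤ ∑ i, (k i : ℝ) := by exact_mod_cast hk'.trans_eq h.sum_eq.symm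
  refine sub_nonpos.1 ?_
  calc paramReward μ k' - paramReward μ k
      = ∑ i, (∑ j ∈ Finset.range (k' i), (1 - μ i) ^ j
          - ∑ j ∈ Finset.range (k i), (1 - μ i) ^ j) := (Finset.sum_sub_distrib _ _).symm
    _ ≤ ∑ i, θ * ((k' i : ℝ) - k i) := Finset.sum_le_sum fun i _ =>
        sum_range_sub_le_of_threshold (antitone_one_sub_pow (hμ i)) (hθ i).1 (hθ i).2 _
    _ = θ * (∑ i, (k' i : ℝ) - ∑ i, (k i : ℝ)) := by
        rw [← Finset.mul_sum, Finset.sum_sub_distrib]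
    _ ≤ 0 := mul_nonpos_of_nonneg_of_nonpos hθ0 (sub_nonpos.2 hle)

-- While `z` is unexplored its marginal gain is `1`, so only a gain of `1` can be preferred to it.
lemma GreedySteps.eq_zero_of_one_lt (h : GreedySteps μ s k) (hμ : ∀ i, μ i ∈ Set.Icc 0 1)
    {z i : Fin m} (hz : k z = 0) (hi : 1 < k i) : μ i = 0 := by
  induction h with
  | zero => simp at hi
  | step _ k l _ hl ih =>
    have hzl : z ≠ l := by
      rintro rfl
      simp at hz
    rw [Function.update_of_ne hzl] at hz
    rcases eq_or_ne i l with rfl | hil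
    · rw [Function.update_self] at hi
      have hgain : 1 ≤ (1 - μ i) ^ k i := by simpa [hz] using hl z
      have hle : (1 - μ i) ^ k i ≤ (1 - μ i) ^ 1 :=
        antitone_one_sub_pow (hμ i) (Nat.le_of_lt_succ hi)
      linarith [(hμ i).1]
    · rw [Function.update_of_ne hil] at hi
      exact ih hz hi

lemma GreedySteps.one_le (h : GreedySteps μ s k) (hμ : ∀ i, μ i ∈ Set.Ioc 0 1) (hs : m ≤ s)
    (z : Fin m) : 1 ≤ k z := by
  by_contra! hz
  have hz : k z = 0 := Nat.lt_one_iff.1 hz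
  obtain ⟨i, hi⟩ := exists_one_lt_of_eq_zero (h.sum_eq.symm ▸ hs) hz
  exact (hμ i).1.ne' (h.eq_zero_of_one_lt (fun i => Set.Ioc_subset_Icc_self (hμ i)) hz hi)

end Greedy

section Smoothness

lemma abs_pow_sub_pow_le_mul {x y : ℝ} (hx : x ∈ Set.Icc 0 1) (hy : y ∈ Set.Icc 0 1) (j : ℕ) :
    |x ^ j - y ^ j| ≤ j * |x - y| := by
  have hmax : max |x| |y| ^ (j - 1) ≤ 1 := by
    rw [abs_of_nonneg hx.1, abs_of_nonneg hy.1]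
    exact pow_le_one₀ (le_max_of_le_left hx.1) (max_le hx.2 hy.2)
  calc |x ^ j - y ^ j| ≤ |x - y| * j * max |x| |y| ^ (j - 1) := abs_pow_sub_pow_le x y j
    _ ≤ |x - y| * j := mul_le_of_le_one_right (by positivity) hmax
    _ = j * |x - y| := mul_comm _ _

lemma abs_sum_pow_sub_le {x y : ℝ} (hx : x ∈ Set.Icc 0 1) (hy : y ∈ Set.Icc 0 1) (n : ℕ) :
    |∑ j ∈ Finset.range n, x ^ j - ∑ j ∈ Finset.range n, y ^ j| ≤ n.choose 2 * |x - y| :=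
  calc |∑ j ∈ Finset.range n, x ^ j - ∑ j ∈ Finset.range n, y ^ j|
      ≤ ∑ j ∈ Finset.range n, |x ^ j - y ^ j| := by
        rw [← Finset.sum_sub_distrib]
        exact Finset.abs_sum_le_sum_abs _ _
    _ ≤ ∑ j ∈ Finset.range n, (j : ℝ) * |x - y| :=
        Finset.sum_le_sum fun j _ => abs_pow_sub_pow_le_mul hx hy j
    _ = n.choose 2 * |x - y| := by
        rw [← Finset.sum_mul, ← Nat.cast_sum, Finset.sum_range_id, Nat.choose_two_right]

lemma sum_choose_two_succ_le {ι : Type*} (s : Finset ι) (a : ι → ℕ) :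
    ∑ i ∈ s, (a i + 1).choose 2 ≤ (∑ i ∈ s, a i + 1).choose 2 := by
  classical
  induction s using Finset.induction_on with
  | empty => simp
  | insert i s hi ih =>
    rw [Finset.sum_insert hi, Finset.sum_insert hi]
    have hsuper (x y : ℕ) : (x + 1).choose 2 + (y + 1).choose 2 ≤ (x + y + 1).choose 2 := by
      rify
      rw [Nat.cast_choose_two, Nat.cast_choose_two, Nat.cast_choose_two]
      push_cast
      nlinarith [mul_nonneg x.cast_nonneg (α := ℝ) y.cast_nonneg]
    exact (Nat.add_le_add_left ih _).trans (hsuper _ _)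

lemma sum_choose_two_le {m : ℕ} {k : Allocation m} (hk : ∀ i, 1 ≤ k i) :
    ∑ i, (k i).choose 2 ≤ (∑ i, k i - m + 1).choose 2 := by
  obtain ⟨a, rfl⟩ : ∃ a : Allocation m, k = fun i => a i + 1 :=
    ⟨fun i => k i - 1, funext fun i => (Nat.sub_add_cancel (hk i)).symm⟩
  simpa [Finset.sum_add_distrib] using sum_choose_two_succ_le Finset.univ a

lemma abs_paramReward_sub_le {m : ℕ} {μ ν : Fin m → ℝ} (hμ : ∀ i, μ i ∈ Set.Icc 0 1)
    (hν : ∀ i, ν i ∈ Set.Icc 0 1) {k : Allocation m} (hk : ∀ i, 1 ≤ k i) {B : ℝ} (hB : 0 ≤ B)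
    (hle : ∀ i, 1 < k i → |μ i - ν i| ≤ B) :
    |paramReward μ k - paramReward ν k| ≤ (∑ i, k i - m + 1).choose 2 * B := by
  have hterm (i : Fin m) : |∑ j ∈ Finset.range (k i), (1 - μ i) ^ j
      - ∑ j ∈ Finset.range (k i), (1 - ν i) ^ j| ≤ (k i).choose 2 * B := by
    refine (abs_sum_pow_sub_le (Set.Icc.one_sub_mem (hμ i)) (Set.Icc.one_sub_mem (hν i)) _).trans ?_
    rcases (hk i).eq_or_lt with h | h
    · simp [← h]
    · rw [sub_sub_sub_cancel_left, abs_sub_comm]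
      gcongr
      exact hle i h
  calc |paramReward μ k - paramReward ν k|
      ≤ ∑ i, ((k i).choose 2 : ℝ) * B := by
        rw [paramReward, paramReward, ← Finset.sum_sub_distrib]
        exact (Finset.abs_sum_le_sum_abs _ _).trans (Finset.sum_le_sum fun i _ => hterm i)
    _ ≤ (∑ i, k i - m + 1).choose 2 * B := by
        rw [← Finset.sum_mul, ← Nat.cast_sum]
        gcongr
        exact sum_choose_two_le hk

end Smoothness

section UniformLaw

open scoped BigOperators

lemma integral_uniformOn_univ {α : Type*} [Fintype α] [MeasurableSpace α]
    [MeasurableSingletonClass α] (f : α → ℝ) :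
    ∫ a, f a ∂(uniformOn Set.univ) = 𝔼 a, f a := by
  rcases isEmpty_or_nonempty α with h | h
  · simp [Measure.eq_zero_of_isEmpty]
  · have := isProbabilityMeasure_uniformOn (Set.finite_univ (α := α)) Set.univ_nonempty
    have hsingleton (a : α) : (uniformOn (Set.univ : Set α)).real {a} = (Fintype.card α : ℝ)⁻¹ := by
      simp [measureReal_def, uniformOn_univ]
    rw [integral_fintype .of_finite, Fintype.expect_eq_sum_div_card]
    simp [hsingleton, ← Finset.mul_sum, div_eq_inv_mul]

lemma expect_prod_fst {α β : Type*} [Fintype α] [Fintype β] [Nonempty β] (f : α → ℝ) :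
    𝔼 p : α × β, f p.1 = 𝔼 a, f a := by
  rw [← Finset.univ_product_univ, Finset.expect_product]
  simp only [Fintype.expect_const]

lemma expect_pi_eval {ι : Type*} [Fintype ι] [DecidableEq ι] {α : ι → Type*}
    [∀ i, Fintype (α i)] [∀ i, Nonempty (α i)] (i : ι) (f : α i → ℝ) :
    𝔼 φ : ∀ i, α i, f (φ i) = 𝔼 a, f a :=
  (Fintype.expect_equiv (Equiv.piSplitAt i α) _ (fun p => f p.1) fun _ => rfl).trans
    (expect_prod_fst f)

lemma expect_ofFn_succ {α : Type*} [Fintype α] (l : ℕ) (F : List α → ℝ) :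
    𝔼 g : Fin (l + 1) → α, F (List.ofFn g)
      = 𝔼 a, 𝔼 g : Fin l → α, F (a :: List.ofFn g) := by
  rw [← Fintype.expect_equiv (Fin.consEquiv fun _ => α) (fun p => F (p.1 :: List.ofFn p.2)) _
    fun p => congrArg F (List.ofFn_cons p.1 p.2).symm,
    ← Finset.univ_product_univ, Finset.expect_product]

lemma expect_take_finRange {α : Type*} [Fintype α] [Nonempty α] {K l : ℕ} (hl : l ≤ K)
    (F : List α → ℝ) :
    𝔼 g : Fin K → α, F (((List.finRange K).take l).map g)
      = 𝔼 g : Fin l → α, F (List.ofFn g) := by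
  obtain ⟨r, rfl⟩ := Nat.exists_eq_add_of_le hl
  rw [← Fintype.expect_equiv (Fin.appendEquiv l r) (fun p => F (List.ofFn p.1)) _ fun p => ?_]
  · exact expect_prod_fst fun g => F (List.ofFn g)
  · rw [List.map_take, ← List.ofFn_eq_map]
    simp [Fin.appendEquiv, List.ofFn_fin_append]

variable {m K : ℕ} {d : Fin m → ℕ}

lemma isProbabilityMeasure_realizationLaw (hd : ∀ i, 1 ≤ d i) :
    IsProbabilityMeasure (realizationLaw d K) :=
  isProbabilityMeasure_uniformOn Set.finite_univ ⟨fun i _ => ⟨0, hd i⟩, trivial⟩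

lemma integral_met (hd : ∀ i, 1 ≤ d i) (i : Fin m) {l : ℕ} (hl : l ≤ K)
    (F : List (Fin (d i)) → ℝ) :
    ∫ φ, F (met φ i l) ∂(realizationLaw d K)
      = 𝔼 g : Fin l → Fin (d i), F (List.ofFn g) := by
  have hne (j : Fin m) : Nonempty (Fin (d j)) := ⟨⟨0, hd j⟩⟩
  rw [realizationLaw, integral_uniformOn_univ, ← expect_take_finRange hl]
  exact expect_pi_eval (α := fun j => Fin K → Fin (d j)) i
    fun g => F (((List.finRange K).take l).map g)

end UniformLaw

section Moments

open scoped BigOperators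

variable {α : Type} [Fintype α] [Nonempty α] [DecidableEq α]

/-- The number of pairs of consecutive members when `n` members are met after the member `u`,
or after no member if `u = none`. -/
def newPairs : Option α → ℕ → ℕ
  | none, n => n - 1
  | some _, n => n

lemma expect_ite_eq_one (v : α) (x : ℝ) :
    𝔼 a, (if v = a then x else 1) = 1 + (x - 1) / Fintype.card α := by
  have hcard : (Fintype.card α : ℝ) ≠ 0 := Nat.cast_ne_zero.2 Fintype.card_ne_zero
  have hite (a : α) : (if v = a then x else 1) = 1 + if v = a then x - 1 else 0 := by
    split_ifs <;> ring
  rw [Fintype.expect_eq_sum_div_card]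
  simp [hite, Finset.sum_add_distrib, add_div, hcard]

lemma expect_notMem_ofFn (v : α) (l : ℕ) :
    𝔼 g : Fin l → α, (if v ∈ List.ofFn g then 0 else 1 : ℝ)
      = (1 - 1 / Fintype.card α) ^ l := by
  induction l with
  | zero => simp
  | succ l ih =>
    have hcons (a : α) (S : List α) : (if v ∈ a :: S then 0 else 1 : ℝ)
        = (if v = a then 0 else 1) * if v ∈ S then 0 else 1 := by
      by_cases h : v = a <;> simp [h]
    rw [expect_ofFn_succ l fun S => if v ∈ S then (0 : ℝ) else 1]
    simp only [hcons, ← Finset.mul_expect, ih]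
    rw [← Finset.expect_mul, expect_ite_eq_one]
    ring

lemma expect_card_toFinset_ofFn (l : ℕ) :
    𝔼 g : Fin l → α, ((List.ofFn g).toFinset.card : ℝ)
      = ∑ j ∈ Finset.range l, (1 - 1 / (Fintype.card α : ℝ)) ^ j := by
  induction l with
  | zero => simp
  | succ l ih =>
    have hcons (a : α) (S : List α) : ((a :: S).toFinset.card : ℝ)
        = S.toFinset.card + if a ∈ S then 0 else 1 := by
      by_cases h : a ∈ S <;> simp [h]
    rw [expect_ofFn_succ l fun S => (S.toFinset.card : ℝ)]
    simp only [hcons, Finset.expect_add_distrib, ih, expect_notMem_ofFn, Fintype.expect_const,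
      Finset.sum_range_succ]

lemma expect_exp_collisions_ofFn (c : ℝ) (u : Option α) (l : ℕ) :
    𝔼 g : Fin l → α, Real.exp (c * collisions u (List.ofFn g))
      = (1 + (Real.exp c - 1) / Fintype.card α) ^ newPairs u l := by
  have hsome (l : ℕ) : ∀ v : α, 𝔼 g : Fin l → α, Real.exp (c * collisions (some v) (List.ofFn g))
      = (1 + (Real.exp c - 1) / Fintype.card α) ^ l := by
    induction l with
    | zero => simp [collisions]
    | succ l ih =>
      intro v
      have hcons (a : α) (S : List α) : Real.exp (c * collisions (some v) (a :: S))
          = (if v = a then Real.exp c else 1) * Real.exp (c * collisions (some a) S) := by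
        by_cases h : v = a <;> simp [collisions, h, mul_add, Real.exp_add]
      rw [expect_ofFn_succ l fun S => Real.exp (c * collisions (some v) S)]
      simp only [hcons, ← Finset.mul_expect, ih]
      rw [← Finset.expect_mul, expect_ite_eq_one, pow_succ']
  match u, l with
  | some v, l => exact hsome l v
  | none, 0 => simp [collisions, newPairs]
  | none, l + 1 =>
    rw [expect_ofFn_succ l fun S => Real.exp (c * collisions none S)]
    simp [collisions, hsome, newPairs]

lemma one_add_mul_exp_sub_one_le {p c : ℝ} (hp : p ∈ Set.Icc 0 1) (hc : |c| ≤ 1) :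
    1 + p * (Real.exp c - 1) ≤ Real.exp (p * c + c ^ 2) := by
  have hexp : Real.exp c - 1 ≤ c + c ^ 2 := by
    linarith [(abs_le.1 (Real.abs_exp_sub_one_sub_id_le hc)).2]
  calc 1 + p * (Real.exp c - 1) ≤ 1 + p * (c + c ^ 2) := by gcongr; exact hp.1
    _ ≤ p * c + c ^ 2 + 1 := by nlinarith [hp.2, sq_nonneg c]
    _ ≤ Real.exp (p * c + c ^ 2) := Real.add_one_le_exp _

end Moments

section Reward

variable {m K : ℕ} {d : Fin m → ℕ}

/-- The vector `μ` of the true collision probabilities `μ_i = 1 / d_i`. -/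
noncomputable def collisionProb (d : Fin m → ℕ) (i : Fin m) : ℝ := 1 / d i

lemma collisionProb_mem_Ioc (hd : ∀ i, 1 ≤ d i) (i : Fin m) :
    collisionProb d i ∈ Set.Ioc 0 1 := by
  have hdi : (1 : ℝ) ≤ d i := by exact_mod_cast hd i
  exact ⟨by unfold collisionProb; positivity, div_le_one_of_le₀ hdi (by positivity)⟩

lemma collisionProb_mem_Icc (hd : ∀ i, 1 ≤ d i) (i : Fin m) :
    collisionProb d i ∈ Set.Icc 0 1 :=
  Set.Ioc_subset_Icc_self (collisionProb_mem_Ioc hd i)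

lemma expReward_eq_paramReward (hd : ∀ i, 1 ≤ d i) {k : Allocation m} (hk : ∑ i, k i ≤ K) :
    expReward d K k = paramReward (collisionProb d) k := by
  have := isProbabilityMeasure_realizationLaw (K := K) hd
  have hne (i : Fin m) : Nonempty (Fin (d i)) := ⟨⟨0, hd i⟩⟩
  simp only [expReward, reward, Nat.cast_sum]
  rw [integral_finsetSum _ fun i _ => .of_finite]
  refine Finset.sum_congr rfl fun i _ => ?_
  have hki : k i ≤ K := (Finset.single_le_sum_of_canonicallyOrdered (Finset.mem_univ i)).trans hk
  rw [integral_met hd i hki fun S => (S.toFinset.card : ℝ), expect_card_toFinset_ofFn,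
    Fintype.card_fin]
  rfl

lemma lintegral_exp_collisions_le (hd : ∀ i, 1 ≤ d i) (i : Fin m) {c : ℝ} (hc : |c| ≤ 1) {l : ℕ}
    (hl : l ≤ K) (u : Option (Fin (d i))) :
    ∫⁻ φ, ENNReal.ofReal (Real.exp (c * collisions u (met φ i l))) ∂(realizationLaw d K)
      ≤ ENNReal.ofReal (Real.exp (newPairs u l * (collisionProb d i * c + c ^ 2))) := by
  have := isProbabilityMeasure_realizationLaw (K := K) hd
  have hne : Nonempty (Fin (d i)) := ⟨⟨0, hd i⟩⟩
  have hμ := collisionProb_mem_Icc hd i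
  rw [← ofReal_integral_eq_lintegral_ofReal .of_finite (.of_forall fun _ => (Real.exp_pos _).le),
    integral_met hd i hl fun S => Real.exp (c * collisions u S), expect_exp_collisions_ofFn,
    Real.exp_nat_mul, Fintype.card_fin, div_eq_inv_mul, ← one_div]
  refine ENNReal.ofReal_le_ofReal (pow_le_pow_left₀ ?_ (one_add_mul_exp_sub_one_le hμ hc) _)
  change 0 ≤ 1 + collisionProb d i * (Real.exp c - 1)
  nlinarith [hμ.1, hμ.2, Real.exp_pos c]

end Reward

section Gap

variable {m K : ℕ} {d : Fin m → ℕ} {kstar k : Allocation m}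

lemma gap_nonneg (hstar : IsOptimal d K kstar) (hk : ∑ i, k i ≤ K) : 0 ≤ gap d K kstar k :=
  sub_nonneg.2 (hstar.2 k hk)

lemma gapMin_le (hK : m < K) (hk : ∑ i, k i = K) (hgap : 0 < gap d K kstar k) :
    gapMin d K kstar ≤ ENNReal.ofReal (gap d K kstar k) := by
  obtain ⟨i, hi⟩ := exists_one_lt_of_lt_sum (hk.symm ▸ hK)
  exact iInf_le_of_le i (iInf₂_le_of_le k ⟨hk, hi, hgap⟩ le_rfl)

lemma le_gapMax (hK : m < K) (hk : ∑ i, k i = K) (hgap : 0 < gap d K kstar k) :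
    ENNReal.ofReal (gap d K kstar k) ≤ gapMax d K kstar := by
  obtain ⟨i, hi⟩ := exists_one_lt_of_lt_sum (hk.symm ▸ hK)
  exact le_iSup_of_le i (le_iSup₂_of_le k ⟨hk, hi, hgap⟩ le_rfl)

lemma gap_eq_paramReward_sub (hd : ∀ i, 1 ≤ d i) (hstar : IsOptimal d K kstar)
    (hk : ∑ i, k i ≤ K) :
    gap d K kstar k = paramReward (collisionProb d) kstar - paramReward (collisionProb d) k := by
  rw [gap, expReward_eq_paramReward hd hstar.1, expReward_eq_paramReward hd hk]

lemma two_mul_choose_two_succ (n : ℕ) : 2 * (n + 1).choose 2 = (n + 1) * n := by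
  rw [mul_comm, ← Nat.add_one_mul_choose_eq, Nat.choose_one_right]

lemma GreedySteps.paramReward_sub_le {s : ℕ} {μ ν : Fin m → ℝ} (h : GreedySteps μ s k)
    (hμ : ∀ i, μ i ∈ Set.Icc 0 1) (hν : ∀ i, ν i ∈ Set.Icc 0 1) (hk : ∀ i, 1 ≤ k i)
    {k' : Allocation m} (hsum : ∑ i, k' i = s) (hk' : ∀ i, 1 ≤ k' i) {B : ℝ}
    (hB : 0 ≤ B) (hle : ∀ i, |μ i - ν i| ≤ B) :
    paramReward ν k' - paramReward ν k ≤ ((s - m + 1) * (s - m) : ℕ) * B := by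
  have hgreedy : paramReward μ k' ≤ paramReward μ k := h.paramReward_le hμ hsum.le
  have hclose := abs_le.1 (abs_paramReward_sub_le hμ hν hk hB fun i _ => hle i)
  have hclose' := abs_le.1 (abs_paramReward_sub_le hμ hν hk' hB fun i _ => hle i)
  rw [h.sum_eq] at hclose
  rw [hsum] at hclose'
  rw [← two_mul_choose_two_succ, Nat.cast_mul, Nat.cast_two]
  linarith [hclose.2, hclose'.1]

lemma GreedySteps.exists_gap_le_of_pos [Nonempty (Fin m)] (hK : m ≤ K) (hd : ∀ i, 1 ≤ d i)
    (hstar : IsOptimal d K kstar) {μ : Fin m → ℝ} (hμ : ∀ i, μ i ∈ Set.Icc 0 1)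
    (h : GreedySteps μ K k) (hk : ∀ i, 1 ≤ k i) :
    ∃ i, gap d K kstar k ≤ ((K - m + 1) * (K - m) : ℕ) * |μ i - collisionProb d i| := by
  obtain ⟨i, hi⟩ := Finite.exists_max fun i => |μ i - collisionProb d i|
  obtain ⟨k', hk'⟩ := exists_greedySteps (collisionProb d) K
  have hopt := hk'.paramReward_le (collisionProb_mem_Icc hd) hstar.1
  have hle := h.paramReward_sub_le hμ (collisionProb_mem_Icc hd) hk hk'.sum_eq
    (hk'.one_le (collisionProb_mem_Ioc hd) hK) (abs_nonneg _) hi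
  refine ⟨i, ?_⟩
  rw [gap_eq_paramReward_sub hd hstar h.sum_eq.le]
  linarith

lemma paramReward_zero (k : Allocation m) : paramReward 0 k = ∑ i, k i := by
  simp [paramReward]

lemma paramReward_le_sum {μ : Fin m → ℝ} (hμ : ∀ i, μ i ∈ Set.Icc 0 1) (k : Allocation m) :
    paramReward μ k ≤ ∑ i, k i := by
  rw [← paramReward_zero]
  refine Finset.sum_le_sum fun i _ => Finset.sum_le_sum fun j _ => ?_
  simpa using pow_le_one₀ (Set.Icc.one_sub_mem (hμ i)).1 (Set.Icc.one_sub_mem (hμ i)).2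

-- An optimal allocation meets at most `K` members, the reward for the parameter vector `0`.
lemma exists_gap_le_mul_collisionProb (hK : m < K) (hd : ∀ i, 1 ≤ d i)
    (hstar : IsOptimal d K kstar) (hsum : ∑ i, k i = K) (hk : ∀ i, 1 ≤ k i) :
    ∃ i, 1 < k i ∧ gap d K kstar k ≤ (K - m + 1).choose 2 * collisionProb d i := by
  obtain ⟨j, hj⟩ := exists_one_lt_of_lt_sum (hsum.symm ▸ hK)
  obtain ⟨i, hi, hmax⟩ := Finset.exists_max_image (Finset.univ.filter fun i => 1 < k i)
    (collisionProb d) ⟨j, by simpa using hj⟩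
  have hμ := collisionProb_mem_Icc hd
  have hclose := abs_paramReward_sub_le (ν := 0) (k := k) hμ (fun _ => by simp) hk (hμ i).1
    fun l hl => by simpa [abs_of_nonneg (hμ l).1] using hmax l (by simpa using hl)
  have hopt : paramReward (collisionProb d) kstar ≤ K :=
    (paramReward_le_sum hμ kstar).trans (by exact_mod_cast hstar.1)
  rw [paramReward_zero, hsum] at hclose
  refine ⟨i, (Finset.mem_filter.1 hi).2, ?_⟩
  rw [gap_eq_paramReward_sub hd hstar hsum.le]
  linarith [(abs_le.1 hclose).1]

-- The action moves the only exploration of `z` to `j`.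
lemma exists_gap_eq_add (hd : ∀ i, 1 ≤ d i) (hstar : IsOptimal d K kstar)
    (hsum : ∑ i, k i = K) {z j : Fin m} (hz : k z = 1) (hjz : j ≠ z) :
    ∃ k', ∑ i, k' i = K ∧
      gap d K kstar k' = gap d K kstar k + (1 - (1 - collisionProb d j) ^ k j) := by
  obtain ⟨a, rfl⟩ : ∃ a : Allocation m, k = a + Pi.single z 1 := by
    refine ⟨k - Pi.single z 1, (tsub_add_cancel_of_le fun l => ?_).symm⟩
    rcases eq_or_ne l z with rfl | hl <;> simp [*]
  have haz : a z = 0 := by simpa using hz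
  have hsum' : ∑ i, (a + Pi.single j 1 : Allocation m) i = K := by
    rwa [sum_add_single, ← sum_add_single a z]
  refine ⟨a + Pi.single j 1, hsum', ?_⟩
  rw [gap_eq_paramReward_sub hd hstar hsum'.le, gap_eq_paramReward_sub hd hstar hsum.le,
    paramReward_add_single, paramReward_add_single, haz]
  simp only [Pi.add_apply, Pi.single_eq_of_ne hjz]
  ring

lemma one_sub_one_sub_pow_le {x : ℝ} (hx : x ∈ Set.Icc 0 1) (n : ℕ) :
    1 - (1 - x) ^ n ≤ n * x := by
  have := one_add_mul_le_pow (a := -x) (by linarith [hx.2]) n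
  rw [← sub_eq_add_neg] at this
  linarith

lemma exists_gapMin_le_of_eq_zero (hK : m < K) (hd : ∀ i, 1 ≤ d i)
    (hstar : IsOptimal d K kstar) (hsum : ∑ i, k i = K) {z : Fin m} (hz : k z = 0) :
    ∃ i, 1 < k i ∧
      gapMin d K kstar ≤ ENNReal.ofReal (((K - m + 1) * (K - m) : ℕ) * collisionProb d i) := by
  obtain ⟨c, ⟨hc, hck⟩, hcsum⟩ := exists_mem_Icc_sum_eq (a := 1) (b := k ⊔ 1) le_sup_right
    (n := K) (by simpa using hK.le) (hsum.ge.trans (Finset.sum_le_sum fun i _ => le_sup_left))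
  have hlt {i : Fin m} (hi : 1 < c i) : 1 < k i := by
    have := hi.trans_le (hck i)
    simpa using this
  rcases (gap_nonneg hstar hcsum.le).eq_or_lt with hgap | hgap
  · obtain ⟨j, hj⟩ := exists_one_lt_of_lt_sum (hcsum.symm ▸ hK)
    have hcz : c z = 1 := le_antisymm (by simpa [hz] using hck z) (hc z)
    obtain ⟨k', hk', hgap'⟩ := exists_gap_eq_add hd hstar hcsum hcz
      (by rintro rfl; exact hj.ne' hcz : j ≠ z)
    have hμ := collisionProb_mem_Ioc hd j
    have hpow : (1 - collisionProb d j) ^ c j < 1 :=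
      pow_lt_one₀ (by linarith [hμ.2]) (by linarith [hμ.1]) (Nat.ne_of_gt (hc j))
    have hcj : c j ≤ (K - m + 1) * (K - m) := by
      have := add_le_of_forall_one_le hc j
      exact (by omega : c j ≤ K - m + 1).trans (Nat.le_mul_of_pos_right _ (Nat.sub_pos_of_lt hK))
    refine ⟨j, hlt hj, (gapMin_le hK hk' (by rw [hgap', ← hgap]; linarith)).trans
      (ENNReal.ofReal_le_ofReal ?_)⟩
    calc gap d K kstar k' = 1 - (1 - collisionProb d j) ^ c j := by rw [hgap', ← hgap, zero_add]
      _ ≤ c j * collisionProb d j := one_sub_one_sub_pow_le (Set.Ioc_subset_Icc_self hμ) _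
      _ ≤ _ := by gcongr; exact hμ.1.le
  · obtain ⟨i, hi, hle⟩ := exists_gap_le_mul_collisionProb hK hd hstar hcsum hc
    refine ⟨i, hlt hi, (gapMin_le hK hcsum hgap).trans (ENNReal.ofReal_le_ofReal (hle.trans ?_))⟩
    gcongr
    · exact (collisionProb_mem_Ioc hd i).1.le
    · rw [← two_mul_choose_two_succ]
      exact Nat.le_mul_of_pos_left _ two_pos

lemma GreedySteps.exists_gapMin_le (hK : m < K) (hd : ∀ i, 1 ≤ d i)
    (hstar : IsOptimal d K kstar) {μ : Fin m → ℝ} (hμ : ∀ i, μ i ∈ Set.Icc 0 1)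
    (h : GreedySteps μ K k) (hgap : 0 < gap d K kstar k) :
    ∃ i, 1 ≤ k i ∧ gapMin d K kstar
      ≤ ((K - m + 1) * (K - m) : ℕ) * ENNReal.ofReal |μ i - collisionProb d i| := by
  simp only [← ENNReal.ofReal_natCast, ← ENNReal.ofReal_mul (Nat.cast_nonneg _)]
  by_cases hz : ∃ z, k z = 0
  · obtain ⟨z, hz⟩ := hz
    obtain ⟨i, hi, hle⟩ := exists_gapMin_le_of_eq_zero hK hd hstar h.sum_eq hz
    have hμi : |μ i - collisionProb d i| = collisionProb d i := by
      rw [h.eq_zero_of_one_lt hμ hz hi, zero_sub, abs_neg,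
        abs_of_nonneg (collisionProb_mem_Icc hd i).1]
    exact ⟨i, hi.le, hμi.symm ▸ hle⟩
  · have hpos (i : Fin m) : 1 ≤ k i := Nat.one_le_iff_ne_zero.2 fun h => hz ⟨i, h⟩
    obtain ⟨i₀, -⟩ := exists_one_lt_of_lt_sum (h.sum_eq.symm ▸ hK)
    have : Nonempty (Fin m) := ⟨i₀⟩
    obtain ⟨i, hi⟩ := h.exists_gap_le_of_pos hK.le hd hstar hμ hpos
    exact ⟨i, hpos i, (gapMin_le hK h.sum_eq hgap).trans (ENNReal.ofReal_le_ofReal hi)⟩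

end Gap

section Statistics

/-- The number of explorations of community `i` in the first `t` rounds. -/
def pulls {m : ℕ} (k : ℕ → Allocation m) (i : Fin m) (t : ℕ) : ℕ := ∑ s ∈ Finset.range t, k s i

lemma collisions_le_newPairs {α : Type} [DecidableEq α] (u : Option α) (S : List α) :
    collisions u S ≤ newPairs u S.length := by
  induction S generalizing u with
  | nil => simp [collisions]
  | cons v S ih =>
    have hv := ih (some v)
    simp only [collisions, newPairs, List.length_cons] at hv ⊢
    cases u with
    | none => simpa using hv
    | some w => split_ifs <;> simp <;> omega

variable {m K : ℕ} {d : Fin m → ℕ} {φ : ℕ → Realization d K} {k : ℕ → Allocation m} {i : Fin m}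
  {t : ℕ}

lemma length_met (φ : Realization d K) (i : Fin m) {n : ℕ} (hn : n ≤ K) :
    (met φ i n).length = n := by
  simp [met, hn]

lemma pulls_succ : pulls k i (t + 1) = pulls k i t + k t i := Finset.sum_range_succ _ _

lemma stats_last_eq_none_iff (hk : ∀ s < t, k s i ≤ K) :
    (stats φ k i t).last = none ↔ pulls k i t = 0 := by
  induction t with
  | zero => simp [stats, pulls]
  | succ t ih =>
    have hlen := length_met (φ t) i (hk t (Nat.lt_succ_self t))
    rw [pulls_succ, Nat.add_eq_zero_iff, ← ih fun s hs => hk s (Nat.lt_succ_of_lt hs)]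
    simp only [stats, Option.or_eq_none_iff, List.getLast?_eq_none_iff]
    rw [← List.length_eq_zero_iff, hlen, and_comm]

lemma pulls_succ_sub_one (hk : ∀ s < t, k s i ≤ K) :
    pulls k i (t + 1) - 1 = pulls k i t - 1 + newPairs (stats φ k i t).last (k t i) := by
  have hlast := stats_last_eq_none_iff (φ := φ) hk
  rw [pulls_succ]
  cases h : (stats φ k i t).last with
  | none =>
    have := hlast.1 h
    simp only [newPairs]
    omega
  | some u =>
    have : pulls k i t ≠ 0 := mt hlast.2 (by simp [h])
    simp only [newPairs]
    omega

lemma stats_T_eq (hk : ∀ s < t, k s i ≤ K) :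
    (stats φ k i t).T = pulls k i t - if t = 0 then 0 else 1 := by
  induction t with
  | zero => simp [stats, pulls]
  | succ t ih =>
    have hlen := length_met (φ t) i (hk t (Nat.lt_succ_self t))
    simp only [stats, ih fun s hs => hk s (Nat.lt_succ_of_lt hs), hlen, pulls_succ]
    push_cast
    split_ifs <;> omega

lemma stats_X_le (hk : ∀ s < t, k s i ≤ K) : (stats φ k i t).X ≤ pulls k i t - 1 := by
  induction t with
  | zero => simp [stats]
  | succ t ih =>
    have hk' : ∀ s < t, k s i ≤ K := fun s hs => hk s (Nat.lt_succ_of_lt hs)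
    have hle := collisions_le_newPairs (stats φ k i t).last (met (φ t) i (k t i))
    rw [length_met _ _ (hk t (Nat.lt_succ_self t))] at hle
    rw [pulls_succ_sub_one (φ := φ) hk']
    exact Nat.add_le_add (ih hk') hle

lemma empMean_eq (hk : ∀ s < t, k s i ≤ K) :
    empMean φ k t i = (stats φ k i t).X / (pulls k i t - 1 : ℕ) := by
  have hT := stats_T_eq (φ := φ) hk
  have hpulls : t = 0 → pulls k i t = 0 := by
    rintro rfl
    rfl
  have hmax : ((pulls k i t - 1 : ℕ) : ℤ) = max (stats φ k i t).T 0 := by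
    split_ifs at hT with ht
    · have := hpulls ht
      omega
    · omega
  rw [empMean]
  split_ifs with h
  · rw [max_eq_left h.le] at hmax
    rw [← hmax, Int.cast_natCast]
  · rw [max_eq_right (not_lt.1 h)] at hmax
    simp [Int.natCast_eq_zero.1 hmax]

lemma empMean_mem_Icc (hk : ∀ s < t, k s i ≤ K) : empMean φ k t i ∈ Set.Icc 0 1 := by
  rw [empMean_eq hk]
  exact ⟨by positivity, div_le_one_of_le₀ (by exact_mod_cast stats_X_le hk) (by positivity)⟩

end Statistics

section Potential

/-- The exponential potential of a community with collision probability `p` that has been explored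
`N` times, so that there are `N - 1` pairs (none if `N = 0`), with `X` collisions: the exponential
moment of the deviation, damped so that it decreases in expectation with every exploration. -/
noncomputable def potential (p c : ℝ) (X N : ℕ) : ℝ≥0∞ :=
  ENNReal.ofReal (Real.exp (c * (X - (N - 1 : ℕ) * p) - c ^ 2 * ((N - 1 : ℕ) + N)))

variable {p c : ℝ}

lemma potential_zero : potential p c 0 0 = 1 := by
  simp [potential]

lemma potential_add {X N x n q : ℕ} (hq : N + n - 1 = N - 1 + q) :
    potential p c (X + x) (N + n) = ENNReal.ofReal (Real.exp (c * x))
      * (ENNReal.ofReal (Real.exp (-(q * (p * c + c ^ 2))))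
        * (ENNReal.ofReal (Real.exp (-(c ^ 2 * n))) * potential p c X N)) := by
  simp only [potential, ← ENNReal.ofReal_mul (Real.exp_pos _).le, ← Real.exp_add, hq]
  congr 2
  push_cast
  ring

lemma one_le_potential {X N : ℕ} (h : 2 * c ^ 2 * (N - 1 : ℕ) ≤ c * (X - (N - 1 : ℕ) * p)) :
    1 ≤ ENNReal.ofReal (Real.exp (c ^ 2)) * potential p c X N := by
  have hN : (N : ℝ) ≤ (N - 1 : ℕ) + 1 := by exact_mod_cast (by omega : N ≤ N - 1 + 1)
  rw [potential, ← ENNReal.ofReal_mul (Real.exp_pos _).le, ← Real.exp_add, ENNReal.one_le_ofReal,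
    Real.one_le_exp_iff]
  nlinarith [mul_le_mul_of_nonneg_left hN (sq_nonneg c)]

lemma one_le_potential_add_potential_neg {X N : ℕ} (hc : 0 ≤ c)
    (h : 2 * c ≤ |(X : ℝ) / (N - 1 : ℕ) - p|) :
    1 ≤ ENNReal.ofReal (Real.exp (c ^ 2)) * (potential p c X N + potential p (-c) X N) := by
  have hdev : 2 * c * (N - 1 : ℕ) ≤ |X - (N - 1 : ℕ) * p| := by
    rcases (N - 1).eq_zero_or_pos with h0 | h0
    · simp [h0]
    · have h0' : (0 : ℝ) < (N - 1 : ℕ) := by exact_mod_cast h0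
      calc 2 * c * (N - 1 : ℕ) ≤ |(X : ℝ) / (N - 1 : ℕ) - p| * |((N - 1 : ℕ) : ℝ)| := by
            rw [abs_of_pos h0']
            gcongr
        _ = |X - (N - 1 : ℕ) * p| := by
            rw [← abs_mul]
            congr 1
            field_simp
  rw [mul_add]
  rcases le_abs.1 hdev with h | h
  · exact (one_le_potential (by nlinarith)).trans le_self_add
  · rw [← neg_sq c]
    exact (one_le_potential (by nlinarith)).trans le_add_self

end Potential

section Independence

variable {Ω α β : Type*} [MeasurableSpace Ω] [MeasurableSpace α] [MeasurableSpace β]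
  {P : Measure Ω} [IsFiniteMeasure P] {X : Ω → α} {Y : Ω → β}

lemma lintegral_prodMk_of_indepFun (h : IndepFun X Y P) (hX : Measurable X) (hY : Measurable Y)
    {f : α × β → ℝ≥0∞} (hf : Measurable f) :
    ∫⁻ ω, f (X ω, Y ω) ∂P = ∫⁻ ω, ∫⁻ y, f (X ω, y) ∂(P.map Y) ∂P := by
  rw [← lintegral_map hf (hX.prodMk hY),
    (indepFun_iff_map_prod_eq_prod_map_map hX.aemeasurable hY.aemeasurable).1 h,
    lintegral_prod _ hf.aemeasurable, lintegral_map hf.lintegral_prod_right' hX]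

lemma integral_prodMk_of_indepFun (h : IndepFun X Y P) (hX : Measurable X) (hY : Measurable Y)
    {f : α × β → ℝ} (hf : StronglyMeasurable f) (hint : Integrable (fun ω => f (X ω, Y ω)) P) :
    ∫ ω, f (X ω, Y ω) ∂P = ∫ ω, ∫ y, f (X ω, y) ∂(P.map Y) ∂P := by
  have hXY : AEMeasurable (fun ω => (X ω, Y ω)) P := (hX.prodMk hY).aemeasurable
  have hmap := (indepFun_iff_map_prod_eq_prod_map_map hX.aemeasurable hY.aemeasurable).1 h
  have hint' := (integrable_map_measure hf.aestronglyMeasurable hXY).2 hint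
  rw [hmap] at hint'
  rw [← integral_map hXY hf.aestronglyMeasurable, hmap, integral_prod _ hint',
    integral_map hX.aemeasurable hf.integral_prod_right'.aestronglyMeasurable]

end Independence

section History

variable {m K : ℕ} {d : Fin m → ℕ} {Ω : Type*} {Φ : ℕ → Ω → Realization d K}
  {k : ℕ → Ω → Allocation m} {t : ℕ}

/-- What has happened up to the choice of the allocation of round `t`, namely the realizations of
the earlier rounds and the allocations up to and including round `t`: the tuple from which
`IsRun` declares the realization of round `t` to be independent. -/
def history (Φ : ℕ → Ω → Realization d K) (k : ℕ → Ω → Allocation m) (t : ℕ) (ω : Ω) :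
    (Fin t → Realization d K) × (Fin (t + 1) → Allocation m) :=
  (fun s => Φ s ω, fun s => k s ω)

lemma stats_congr {φ φ' : ℕ → Realization d K} {κ κ' : ℕ → Allocation m} (i : Fin m)
    (hφ : ∀ s < t, φ s = φ' s) (hκ : ∀ s < t, κ s = κ' s) :
    stats φ κ i t = stats φ' κ' i t := by
  induction t with
  | zero => rfl
  | succ t ih =>
    simp only [stats, hφ t (Nat.lt_succ_self t), hκ t (Nat.lt_succ_self t),
      ih (fun s hs => hφ s (Nat.lt_succ_of_lt hs)) fun s hs => hκ s (Nat.lt_succ_of_lt hs)]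

lemma factorsThrough_history (i : Fin m) :
    (fun ω => (stats (Φ · ω) (k · ω) i t, pulls (k · ω) i t, k t ω i)).FactorsThrough
      (history Φ k t) := by
  intro ω ω' h
  have hΦ : ∀ s < t, Φ s ω = Φ s ω' := fun s hs => congrFun (congrArg Prod.fst h) ⟨s, hs⟩
  have hk : ∀ s < t + 1, k s ω = k s ω' := fun s hs => congrFun (congrArg Prod.snd h) ⟨s, hs⟩
  have hk' : ∀ s < t, k s ω = k s ω' := fun s hs => hk s (Nat.lt_succ_of_lt hs)
  have hpulls : pulls (k · ω) i t = pulls (k · ω') i t :=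
    Finset.sum_congr rfl fun s hs => congrFun (hk' s (Finset.mem_range.1 hs)) i
  simp only [stats_congr i hΦ hk', hpulls, hk t (Nat.lt_succ_self t)]

end History

section Run

variable {m K T : ℕ} {d : Fin m → ℕ} {Ω : Type*} [MeasurableSpace Ω] {P : Measure Ω}
  {Φ : ℕ → Ω → Realization d K} {k : ℕ → Ω → Allocation m} {t : ℕ}

lemma IsRun.measurable_history (hrun : IsRun d K T P Φ k) (ht : t < T) :
    Measurable (history Φ k t) :=
  (measurable_pi_lambda _ fun s : Fin t =>
    hrun.measurable_realization s (s.2.trans ht)).prodMk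
    (measurable_pi_lambda _ fun s : Fin (t + 1) =>
      hrun.measurable_allocation s ((Nat.lt_succ_iff.1 s.2).trans_lt ht))

lemma IsRun.lintegral_eq [IsProbabilityMeasure P] (hrun : IsRun d K T P Φ k) (ht : t < T)
    {β : Type*} {X : Ω → β} (hX : X.FactorsThrough (history Φ k t))
    (f : β → Realization d K → ℝ≥0∞) :
    ∫⁻ ω, f (X ω) (Φ t ω) ∂P = ∫⁻ ω, ∫⁻ φ, f (X ω) φ ∂realizationLaw d K ∂P := by
  have : Nonempty β := P.nonempty_of_neZero.map X
  obtain ⟨g, rfl⟩ := (Function.factorsThrough_iff X).1 hX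
  rw [← hrun.law t ht]
  exact lintegral_prodMk_of_indepFun (f := fun p => f (g p.1) p.2) (hrun.indep t ht)
    (hrun.measurable_history ht) (hrun.measurable_realization t ht) .of_discrete

lemma IsRun.allocation_le (hrun : IsRun d K T P Φ k) (ht : t < T) (ω : Ω) (i : Fin m) :
    k t ω i ≤ K :=
  (hrun.greedy t ht ω).sum_eq ▸ Finset.single_le_sum (fun _ _ => Nat.zero_le _) (Finset.mem_univ i)

lemma IsRun.measurableSet_allocation (hrun : IsRun d K T P Φ k) (ht : t < T)
    (s : Set (Allocation m)) : MeasurableSet {ω | k t ω ∈ s} :=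
  hrun.measurable_allocation t ht .of_discrete

end Run

section Concentration

variable {m K T : ℕ} {d : Fin m → ℕ} {Ω : Type*} [MeasurableSpace Ω] {P : Measure Ω}
  {Φ : ℕ → Ω → Realization d K} {k : ℕ → Ω → Allocation m} {t : ℕ} {c : ℝ}

/-- The potential of community `i` at the beginning of round `t` of a run. -/
noncomputable def runPotential (Φ : ℕ → Ω → Realization d K) (k : ℕ → Ω → Allocation m) (c : ℝ)
    (i : Fin m) (t : ℕ) (ω : Ω) : ℝ≥0∞ :=
  potential (collisionProb d i) c (stats (Φ · ω) (k · ω) i t).X (pulls (k · ω) i t)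

lemma IsRun.measurable_runPotential (hrun : IsRun d K T P Φ k) (ht : t < T)
    (i : Fin m) : Measurable (runPotential Φ k c i t) := by
  have hfac : (runPotential Φ k c i t).FactorsThrough (history Φ k t) :=
    (factorsThrough_history i).comp_left fun x => potential (collisionProb d i) c x.1.X x.2.1
  obtain ⟨g, hg⟩ := (Function.factorsThrough_iff _).1 hfac
  rw [hg]
  exact Measurable.of_discrete.comp (hrun.measurable_history ht)

lemma IsRun.lintegral_runPotential_succ_le [IsProbabilityMeasure P] (hrun : IsRun d K T P Φ k)
    (hd : ∀ i, 1 ≤ d i) (hc : |c| ≤ 1) (ht : t < T) (i : Fin m) :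
    ∫⁻ ω, runPotential Φ k c i (t + 1) ω ∂P
      ≤ ∫⁻ ω, ENNReal.ofReal (Real.exp (-(c ^ 2 * k t ω i))) * runPotential Φ k c i t ω ∂P := by
  have hsucc (ω : Ω) : runPotential Φ k c i (t + 1) ω = potential (collisionProb d i) c
      ((stats (Φ · ω) (k · ω) i t).X
        + collisions (stats (Φ · ω) (k · ω) i t).last (met (Φ t ω) i (k t ω i)))
      (pulls (k · ω) i t + k t ω i) := by
    rw [runPotential, pulls_succ]
    rfl
  simp only [hsucc]
  rw [hrun.lintegral_eq ht (factorsThrough_history i) fun x φ =>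
    potential (collisionProb d i) c (x.1.X + collisions x.1.last (met φ i x.2.2)) (x.2.1 + x.2.2)]
  refine lintegral_mono fun ω => ?_
  have hk : ∀ s < t, k s ω i ≤ K := fun s hs => hrun.allocation_le (hs.trans ht) ω i
  have hpairs := pulls_succ_sub_one (φ := (Φ · ω)) (k := (k · ω)) hk
  rw [pulls_succ] at hpairs
  simp only [potential_add hpairs]
  rw [lintegral_mul_const _ .of_discrete]
  calc _ ≤ _ :=
        mul_le_mul_left (lintegral_exp_collisions_le hd i hc (hrun.allocation_le ht ω i) _) _
    _ = _ := by
      rw [← mul_assoc, ← ENNReal.ofReal_mul (Real.exp_pos _).le, ← Real.exp_add, add_neg_cancel,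
        Real.exp_zero, ENNReal.ofReal_one, one_mul]
      rfl

lemma exp_mul_add_one_sub_exp_mul_le (c : ℝ) (V : ℝ≥0∞) {n : ℕ} (hn : 1 ≤ n) :
    ENNReal.ofReal (Real.exp (-(c ^ 2 * n))) * V
      + ENNReal.ofReal (1 - Real.exp (-c ^ 2)) * V ≤ V := by
  have hexp : Real.exp (-(c ^ 2 * n)) ≤ Real.exp (-c ^ 2) :=
    Real.exp_le_exp.2 (neg_le_neg (le_mul_of_one_le_right (sq_nonneg c) (by exact_mod_cast hn)))
  have hle : Real.exp (-c ^ 2) ≤ 1 := Real.exp_le_one_iff.2 (neg_nonpos.2 (sq_nonneg c))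
  rw [← add_mul, ← ENNReal.ofReal_add (Real.exp_pos _).le (sub_nonneg.2 hle)]
  exact mul_le_of_le_one_left' (ENNReal.ofReal_le_one.2 (by linarith))

lemma IsRun.lintegral_runPotential_add_sum_le [IsProbabilityMeasure P]
    (hrun : IsRun d K T P Φ k) (hd : ∀ i, 1 ≤ d i) (hc : |c| ≤ 1) (ht : t ≤ T) (i : Fin m) :
    ∫⁻ ω, runPotential Φ k c i t ω ∂P + ENNReal.ofReal (1 - Real.exp (-c ^ 2))
      * ∑ s ∈ Finset.range t, ∫⁻ ω in {ω | 1 ≤ k s ω i}, runPotential Φ k c i s ω ∂P ≤ 1 := by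
  induction t with
  | zero => simp [runPotential, stats, pulls, potential_zero]
  | succ t ih =>
    refine le_trans ?_ (ih (Nat.le_of_succ_le ht))
    rw [Finset.sum_range_succ, mul_add, ← add_assoc, add_right_comm]
    refine add_le_add_left ?_ _
    have hE : MeasurableSet {ω | 1 ≤ k t ω i} := hrun.measurableSet_allocation ht {a | 1 ≤ a i}
    calc _ ≤ ∫⁻ ω, ENNReal.ofReal (Real.exp (-(c ^ 2 * k t ω i))) * runPotential Φ k c i t ω ∂P
          + ∫⁻ ω, ENNReal.ofReal (1 - Real.exp (-c ^ 2))
            * {ω | 1 ≤ k t ω i}.indicator (runPotential Φ k c i t) ω ∂P := by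
          rw [← lintegral_indicator hE]
          exact add_le_add (hrun.lintegral_runPotential_succ_le hd hc ht i)
            (lintegral_const_mul_le _ _)
      _ ≤ ∫⁻ ω, runPotential Φ k c i t ω ∂P := by
          refine (le_lintegral_add _ _).trans (lintegral_mono fun ω => ?_)
          by_cases h : 1 ≤ k t ω i
          · simpa [h] using exp_mul_add_one_sub_exp_mul_le c (runPotential Φ k c i t ω) h
          · simp [Nat.lt_one_iff.1 (not_le.1 h)]

lemma IsRun.sum_setLIntegral_runPotential_le [IsProbabilityMeasure P] (hrun : IsRun d K T P Φ k)
    (hd : ∀ i, 1 ≤ d i) (hc0 : c ≠ 0) (hc : |c| ≤ 1) (i : Fin m) :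
    ∑ t ∈ Finset.range T, ∫⁻ ω in {ω | 1 ≤ k t ω i}, runPotential Φ k c i t ω ∂P
      ≤ ENNReal.ofReal (1 / (1 - Real.exp (-c ^ 2))) := by
  have hpos : 0 < 1 - Real.exp (-c ^ 2) :=
    sub_pos.2 (Real.exp_lt_one_iff.2 (neg_lt_zero.2 (sq_pos_of_ne_zero hc0)))
  rw [ENNReal.ofReal_div_of_pos hpos, ENNReal.ofReal_one, ENNReal.le_div_iff_mul_le
    (.inl (ENNReal.ofReal_pos.2 hpos).ne') (.inl ENNReal.ofReal_ne_top), mul_comm]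
  exact le_add_self.trans (hrun.lintegral_runPotential_add_sum_le hd hc le_rfl i)

lemma IsRun.measure_two_mul_le_abs_empMean_sub_le (hrun : IsRun d K T P Φ k) (hc : 0 ≤ c)
    (ht : t < T) (i : Fin m) :
    P {ω | 1 ≤ k t ω i ∧ 2 * c ≤ |empMean (Φ · ω) (k · ω) t i - collisionProb d i|}
      ≤ ENNReal.ofReal (Real.exp (c ^ 2))
        * (∫⁻ ω in {ω | 1 ≤ k t ω i}, runPotential Φ k c i t ω ∂P
          + ∫⁻ ω in {ω | 1 ≤ k t ω i}, runPotential Φ k (-c) i t ω ∂P) := by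
  have hE : MeasurableSet {ω | 1 ≤ k t ω i} := hrun.measurableSet_allocation ht {a | 1 ≤ a i}
  have hV (b : ℝ) := hrun.measurable_runPotential (c := b) ht i
  have hW : Measurable fun ω => ENNReal.ofReal (Real.exp (c ^ 2))
      * (runPotential Φ k c i t ω + runPotential Φ k (-c) i t ω) :=
    ((hV c).add (hV (-c))).const_mul _
  have hmarkov := mul_meas_ge_le_lintegral (μ := P.restrict {ω | 1 ≤ k t ω i}) hW 1
  rw [one_mul, Measure.restrict_apply' hE, lintegral_const_mul _ (by exact (hV c).add (hV (-c))),
    lintegral_add_left (hV c)] at hmarkov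
  refine le_trans (measure_mono ?_) hmarkov
  rintro ω ⟨hexplored, hdev⟩
  rw [empMean_eq fun s hs => hrun.allocation_le (hs.trans ht) ω i] at hdev
  exact ⟨one_le_potential_add_potential_neg hc hdev, hexplored⟩

lemma exp_div_one_sub_exp_le {x : ℝ} (hx0 : 0 < x) (hx1 : x ≤ 1 / 4) :
    Real.exp x / (1 - Real.exp (-x)) ≤ Real.exp 1 ^ 2 / (4 * x) := by
  have hlower : x * Real.exp (-x) ≤ 1 - Real.exp (-x) := by
    have := mul_le_mul_of_nonneg_right (Real.add_one_le_exp x) (Real.exp_pos (-x)).le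
    rw [← Real.exp_add, add_neg_cancel, Real.exp_zero] at this
    linarith
  have hfour : 4 ≤ Real.exp 1 * Real.exp (1 - 2 * x) := by
    nlinarith [Real.exp_one_gt_d9, Real.add_one_le_exp (1 - 2 * x)]
  have hpos : 0 < x * Real.exp (-x) := mul_pos hx0 (Real.exp_pos _)
  rw [div_le_div_iff₀ (hpos.trans_le hlower) (by positivity)]
  calc Real.exp x * (4 * x)
      ≤ Real.exp x * (Real.exp 1 * Real.exp (1 - 2 * x) * x) := by gcongr
    _ = Real.exp 1 ^ 2 * (x * Real.exp (-x)) := by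
        have : Real.exp x * Real.exp (1 - 2 * x) = Real.exp 1 * Real.exp (-x) := by
          rw [← Real.exp_add, ← Real.exp_add]
          congr 1
          ring
        linear_combination Real.exp 1 * x * this
    _ ≤ Real.exp 1 ^ 2 * (1 - Real.exp (-x)) := by gcongr

lemma IsRun.sum_measure_le_of_pos [IsProbabilityMeasure P] (hrun : IsRun d K T P Φ k)
    (hd : ∀ i, 1 ≤ d i) (hc0 : 0 < c) (hc : 2 * c ≤ 1) (i : Fin m) :
    ∑ t ∈ Finset.range T,
        P {ω | 1 ≤ k t ω i ∧ 2 * c ≤ |empMean (Φ · ω) (k · ω) t i - collisionProb d i|}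
      ≤ ENNReal.ofReal (2 * Real.exp 1 ^ 2 / (2 * c) ^ 2) := by
  have hpos := hrun.sum_setLIntegral_runPotential_le hd hc0.ne'
    (by rw [abs_of_pos hc0]; linarith) i
  have hneg := hrun.sum_setLIntegral_runPotential_le hd (neg_ne_zero.2 hc0.ne')
    (by rw [abs_neg, abs_of_pos hc0]; linarith) i
  rw [neg_sq] at hneg
  have hone : 0 ≤ 1 / (1 - Real.exp (-c ^ 2)) :=
    one_div_nonneg.2 (sub_nonneg.2 (Real.exp_le_one_iff.2 (neg_nonpos.2 (sq_nonneg c))))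
  calc _ ≤ _ := Finset.sum_le_sum fun t ht =>
        hrun.measure_two_mul_le_abs_empMean_sub_le hc0.le (Finset.mem_range.1 ht) i
    _ ≤ ENNReal.ofReal (Real.exp (c ^ 2)) * (ENNReal.ofReal (1 / (1 - Real.exp (-c ^ 2)))
          + ENNReal.ofReal (1 / (1 - Real.exp (-c ^ 2)))) := by
        rw [← Finset.mul_sum, Finset.sum_add_distrib]
        gcongr
    _ = ENNReal.ofReal (2 * (Real.exp (c ^ 2) / (1 - Real.exp (-c ^ 2)))) := by
        rw [← ENNReal.ofReal_add hone hone, ← ENNReal.ofReal_mul (Real.exp_pos _).le]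
        congr 1
        ring
    _ ≤ _ := by
        refine ENNReal.ofReal_le_ofReal ?_
        calc _ ≤ 2 * (Real.exp 1 ^ 2 / (4 * c ^ 2)) := by
              refine mul_le_mul_of_nonneg_left ?_ zero_le_two
              exact exp_div_one_sub_exp_le (by positivity) (by nlinarith)
          _ = _ := by ring

lemma IsRun.sum_measure_le_abs_empMean_sub_le [IsProbabilityMeasure P]
    (hrun : IsRun d K T P Φ k) (hd : ∀ i, 1 ≤ d i) (ε : ℝ≥0∞) (i : Fin m) :
    ∑ t ∈ Finset.range T, P {ω | 1 ≤ k t ω i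
        ∧ ε ≤ ENNReal.ofReal |empMean (Φ · ω) (k · ω) t i - collisionProb d i|}
      ≤ 2 * ENNReal.ofReal (Real.exp 1) ^ 2 / ε ^ 2 := by
  rcases eq_or_ne ε 0 with rfl | hε0
  · simp [ENNReal.div_zero, Real.exp_pos]
  rcases le_or_gt ε 1 with hε1 | hε1
  · lift ε to NNReal using (hε1.trans_lt ENNReal.one_lt_top).ne
    have hε : 0 < (ε : ℝ) := NNReal.coe_pos.2 (pos_of_ne_zero (by exact_mod_cast hε0))
    have h := hrun.sum_measure_le_of_pos (c := ε / 2) hd (by positivity)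
      (by linarith [show (ε : ℝ) ≤ 1 by exact_mod_cast hε1]) i
    rw [mul_div_cancel₀ _ two_ne_zero, ENNReal.ofReal_div_of_pos (by positivity),
      ENNReal.ofReal_mul zero_le_two, ENNReal.ofReal_pow (Real.exp_pos _).le,
      ENNReal.ofReal_pow hε.le, ENNReal.ofReal_ofNat, ENNReal.ofReal_coe_nnreal] at h
    simpa only [ENNReal.le_ofReal_iff_toReal_le ENNReal.coe_ne_top (abs_nonneg _),
      ENNReal.coe_toReal] using h
  · refine (Finset.sum_eq_zero fun t ht => ?_).trans_le zero_le
    refine measure_mono_null (fun ω hω => ?_) measure_empty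
    have hp := collisionProb_mem_Icc hd i
    have hemp := empMean_mem_Icc (φ := (Φ · ω)) (k := (k · ω)) fun s hs =>
      hrun.allocation_le (hs.trans (Finset.mem_range.1 ht)) ω i
    have hle : |empMean (Φ · ω) (k · ω) t i - collisionProb d i| ≤ 1 :=
      abs_sub_le_of_nonneg_of_le hemp.1 hemp.2 hp.1 hp.2
    exact absurd (hω.2.trans (ENNReal.ofReal_le_one.2 hle)) (not_le.2 hε1)

end Concentration

section Regret

variable {m K T : ℕ} {d : Fin m → ℕ} {Ω : Type*} [MeasurableSpace Ω] {P : Measure Ω}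
  {Φ : ℕ → Ω → Realization d K} {k : ℕ → Ω → Allocation m}
  {kstar : Allocation m} {t : ℕ}

lemma reward_le (a : Allocation m) (φ : Realization d K) : reward a φ ≤ ∑ i, d i :=
  Finset.sum_le_sum fun _ _ => (Finset.card_le_univ _).trans (Fintype.card_fin _).le

lemma IsRun.measurable_apply (hrun : IsRun d K T P Φ k) (ht : t < T)
    (f : Allocation m → Realization d K → ℝ) : Measurable fun ω => f (k t ω) (Φ t ω) :=
  (Measurable.of_discrete (f := Function.uncurry f)).comp
    ((hrun.measurable_allocation t ht).prodMk (hrun.measurable_realization t ht))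

lemma IsRun.integral_apply [IsProbabilityMeasure P] (hrun : IsRun d K T P Φ k) (ht : t < T)
    {f : Allocation m → Realization d K → ℝ}
    (hint : Integrable (fun ω => f (k t ω) (Φ t ω)) P) :
    ∫ ω, f (k t ω) (Φ t ω) ∂P = ∫ ω, ∫ φ, f (k t ω) φ ∂realizationLaw d K ∂P := by
  have hindep : IndepFun (k t) (Φ t) P := (hrun.indep t ht).comp
    (φ := fun p : (Fin t → Realization d K) × (Fin (t + 1) → Allocation m) => p.2 (Fin.last t))
    (ψ := id) .of_discrete measurable_id
  rw [← hrun.law t ht]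
  exact integral_prodMk_of_indepFun (f := Function.uncurry f) hindep
    (hrun.measurable_allocation t ht) (hrun.measurable_realization t ht)
    Measurable.of_discrete.stronglyMeasurable hint

lemma IsRun.integrable_reward_sub [IsProbabilityMeasure P] (hrun : IsRun d K T P Φ k)
    (kstar : Allocation m) (ht : t < T) :
    Integrable (fun ω => (reward kstar (Φ t ω) : ℝ) - reward (k t ω) (Φ t ω)) P := by
  have hmeas := hrun.measurable_apply ht fun a φ => (reward kstar φ : ℝ) - reward a φ
  have hle (a : Allocation m) (φ : Realization d K) : (reward a φ : ℝ) ≤ (∑ i, d i : ℕ) :=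
    Nat.cast_le.2 (reward_le a φ)
  refine .of_bound hmeas.aestronglyMeasurable (∑ i, d i : ℕ) (.of_forall fun ω => ?_)
  rw [Real.norm_eq_abs]
  exact abs_sub_le_of_nonneg_of_le (Nat.cast_nonneg _) (hle _ _) (Nat.cast_nonneg _) (hle _ _)

lemma IsRun.integral_reward_sub [IsProbabilityMeasure P] (hrun : IsRun d K T P Φ k)
    (hd : ∀ i, 1 ≤ d i) (kstar : Allocation m) (ht : t < T) :
    ∫ ω, ((reward kstar (Φ t ω) : ℝ) - reward (k t ω) (Φ t ω)) ∂P
      = ∫ ω, gap d K kstar (k t ω) ∂P := by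
  have := isProbabilityMeasure_realizationLaw (K := K) hd
  rw [hrun.integral_apply (f := fun a φ => (reward kstar φ : ℝ) - reward a φ) ht
    (hrun.integrable_reward_sub kstar ht)]
  exact integral_congr_ae (.of_forall fun ω => integral_sub .of_finite .of_finite)

lemma IsRun.regret_eq_sum_integral_gap [IsProbabilityMeasure P] (hrun : IsRun d K T P Φ k)
    (hd : ∀ i, 1 ≤ d i) (kstar : Allocation m) :
    regret T P Φ k kstar = ∑ t ∈ Finset.range T, ∫ ω, gap d K kstar (k t ω) ∂P := by
  rw [regret, integral_finsetSum _ fun t ht =>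
    hrun.integrable_reward_sub kstar (Finset.mem_range.1 ht)]
  exact Finset.sum_congr rfl fun t ht =>
    hrun.integral_reward_sub hd kstar (Finset.mem_range.1 ht)

lemma IsRun.ofReal_integral_gap_le (hrun : IsRun d K T P Φ k) (hK : m < K)
    (hstar : IsOptimal d K kstar) (ht : t < T) :
    ENNReal.ofReal (∫ ω, gap d K kstar (k t ω) ∂P)
      ≤ gapMax d K kstar * P {ω | 0 < gap d K kstar (k t ω)} := by
  have hsum (ω : Ω) : ∑ i, k t ω i = K := (hrun.greedy t ht ω).sum_eq
  have hpos : MeasurableSet {ω | 0 < gap d K kstar (k t ω)} :=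
    hrun.measurableSet_allocation ht {a | 0 < gap d K kstar a}
  calc ENNReal.ofReal (∫ ω, gap d K kstar (k t ω) ∂P)
      ≤ ∫⁻ ω, ‖gap d K kstar (k t ω)‖ₑ ∂P :=
        (Real.ofReal_le_enorm _).trans (enorm_integral_le_lintegral_enorm _)
    _ ≤ ∫⁻ ω, {ω | 0 < gap d K kstar (k t ω)}.indicator (fun _ => gapMax d K kstar) ω ∂P := by
        refine lintegral_mono fun ω => ?_
        rcases (gap_nonneg hstar (hsum ω).le).eq_or_lt with h | h
        · simp [← h]
        · rw [Real.enorm_of_nonneg h.le, Set.indicator_of_mem (by exact h)]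
          exact le_gapMax hK (hsum ω) h
    _ = gapMax d K kstar * P {ω | 0 < gap d K kstar (k t ω)} := lintegral_indicator_const hpos _

lemma IsRun.ofReal_regret_le [IsProbabilityMeasure P] (hrun : IsRun d K T P Φ k)
    (hK : m < K) (hd : ∀ i, 1 ≤ d i) (hstar : IsOptimal d K kstar) :
    ENNReal.ofReal (regret T P Φ k kstar)
      ≤ gapMax d K kstar * ∑ t ∈ Finset.range T, P {ω | 0 < gap d K kstar (k t ω)} := by
  rw [hrun.regret_eq_sum_integral_gap hd, Finset.mul_sum]
  exact (Finset.le_sum_of_subadditive _ ENNReal.ofReal_zero.le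
    (fun _ _ => ENNReal.ofReal_add_le) _ _).trans
      (Finset.sum_le_sum fun t ht => hrun.ofReal_integral_gap_le hK hstar (Finset.mem_range.1 ht))

lemma IsRun.measure_gap_pos_le (hrun : IsRun d K T P Φ k) (hK : m < K) (hd : ∀ i, 1 ≤ d i)
    (hstar : IsOptimal d K kstar) (ht : t < T) :
    P {ω | 0 < gap d K kstar (k t ω)} ≤ ∑ i, P {ω | 1 ≤ k t ω i
      ∧ gapMin d K kstar / ((K - m + 1) * (K - m) : ℕ)
        ≤ ENNReal.ofReal |empMean (Φ · ω) (k · ω) t i - collisionProb d i|} := by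
  refine (measure_mono fun ω hω => Set.mem_iUnion.2 ?_).trans (measure_iUnion_fintype_le P _)
  have hemp (i : Fin m) : empMean (Φ · ω) (k · ω) t i ∈ Set.Icc 0 1 :=
    empMean_mem_Icc fun s hs => hrun.allocation_le (hs.trans ht) ω i
  obtain ⟨i, hi, hle⟩ := (hrun.greedy t ht ω).exists_gapMin_le hK hd hstar hemp hω
  exact ⟨i, hi, ENNReal.div_le_of_le_mul' hle⟩

lemma IsRun.sum_measure_gap_pos_le [IsProbabilityMeasure P] (hrun : IsRun d K T P Φ k)
    (hK : m < K) (hd : ∀ i, 1 ≤ d i) (hstar : IsOptimal d K kstar) :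
    ∑ t ∈ Finset.range T, P {ω | 0 < gap d K kstar (k t ω)}
      ≤ 2 * (m : ℝ≥0∞) * ENNReal.ofReal (Real.exp 1) ^ 2 * ((K - m + 1 : ℕ) : ℝ≥0∞) ^ 2
          * ((K - m : ℕ) : ℝ≥0∞) ^ 2 / gapMin d K kstar ^ 2 := by
  set A : ℕ := (K - m + 1) * (K - m)
  have hA : A ≠ 0 := mul_ne_zero (Nat.succ_ne_zero _) (Nat.sub_ne_zero_of_lt hK)
  calc _ ≤ _ := Finset.sum_le_sum fun t ht =>
        hrun.measure_gap_pos_le hK hd hstar (Finset.mem_range.1 ht)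
    _ ≤ ∑ _i : Fin m, 2 * ENNReal.ofReal (Real.exp 1) ^ 2 / (gapMin d K kstar / A) ^ 2 := by
        rw [Finset.sum_comm]
        exact Finset.sum_le_sum fun i _ => hrun.sum_measure_le_abs_empMean_sub_le hd _ i
    _ = 2 * (m : ℝ≥0∞) * ENNReal.ofReal (Real.exp 1) ^ 2 * A ^ 2 / gapMin d K kstar ^ 2 := by
        rw [Finset.sum_const, Finset.card_univ, Fintype.card_fin, nsmul_eq_mul, div_eq_mul_inv,
          ENNReal.inv_pow, ENNReal.inv_div (.inl (ENNReal.natCast_ne_top _))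
          (.inl (Nat.cast_ne_zero.2 hA)), div_eq_mul_inv, mul_pow, div_eq_mul_inv, ENNReal.inv_pow]
        ring
    _ = _ := by rw [Nat.cast_mul, mul_pow, ← mul_assoc]

end Regret

end CommunityExploration

open CommunityExploration in
theorem theorem4_general (m K T : ℕ) (hK : m < K) (d : Fin m → ℕ) (hd : ∀ i, 1 ≤ d i)
    {Ω : Type*} [MeasurableSpace Ω] (P : Measure Ω) [IsProbabilityMeasure P]
    (Φ : ℕ → Ω → Realization d K) (k : ℕ → Ω → Allocation m) (hrun : IsRun d K T P Φ k)
    (kstar : Allocation m) (hstar : IsOptimal d K kstar) :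
    ((regret T P Φ k kstar : ℝ) : EReal)
      ≤ ((2 * (m : ℝ≥0∞) * ENNReal.ofReal (Real.exp 1) ^ 2 * ((K - m + 1 : ℕ) : ℝ≥0∞) ^ 2
            * ((K - m : ℕ) : ℝ≥0∞) ^ 2 / gapMin d K kstar ^ 2
          * gapMax d K kstar : ℝ≥0∞) : EReal) := by
  calc ((regret T P Φ k kstar : ℝ) : EReal)
      ≤ (ENNReal.ofReal (regret T P Φ k kstar) : EReal) := by
        rw [EReal.coe_ennreal_ofReal]
        exact EReal.coe_le_coe_iff.2 (le_max_left _ _)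
    _ ≤ _ := by
        rw [EReal.coe_ennreal_le_coe_ennreal_iff, mul_comm]
        exact (hrun.ofReal_regret_le hK hd hstar).trans
          (mul_le_mul_right (hrun.sum_measure_gap_pos_le hK hd hstar) _)

theorem theorem4 (m K T : ℕ) (hK : m < K) (d : Fin m → ℕ) (hd : ∀ i, 1 ≤ d i)
    {Ω : Type*} [MeasurableSpace Ω] (P : Measure Ω) [IsProbabilityMeasure P]
    (Φ : ℕ → Ω → CommunityExploration.Realization d K)
    (k : ℕ → Ω → CommunityExploration.Allocation m)
    (hrun : CommunityExploration.IsRun d K T P Φ k)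
    (kstar : CommunityExploration.Allocation m)
    (hstar : CommunityExploration.IsOptimal d K kstar)
    (K' : ℕ) (hK' : K' = K - m + 1) :
    ((CommunityExploration.regret T P Φ k kstar : ℝ) : EReal) ≤
      (((2 + 2 * (m : ℝ≥0∞) * ENNReal.ofReal (Real.exp 1) ^ 2 * (K' : ℝ≥0∞) ^ 2
            * ((K' - 1 : ℕ) : ℝ≥0∞) ^ 2 / CommunityExploration.gapMin d K kstar ^ 2)
          * CommunityExploration.gapMax d K kstar : ℝ≥0∞) : EReal) := by
  subst hK'
  exact (theorem4_general m K T hK d hd P Φ k hrun kstar hstar).trans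
    (EReal.coe_ennreal_le_coe_ennreal_iff.2 (mul_le_mul_left le_add_self _))
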